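/- Let $(E,\mathcal E)$ be a Polish measurable space, i.e. $\mathcal E$ is the Borel $\sigma$-algebra of some separable completely metrizable topology on $E$. Let $X^+=(X^+_t)_{t=0,1,2,\dots}$ and $X^-=(X^-_t)_{t=0,1,2,\dots}$ be two discrete-time $E$-valued random processes (possibly defined on different probability spaces, with no Markov assumption) that start at the same fixed point: there is $x_0\in E$ with $X^+_0=x_0$ and $X^-_0=x_0$ almost surely. Then a MEXIT (maximal exit) coupling of $X^+$ and $X^-$ through all time exists. That is, there is a probability measure $m$ on $E^{\mathbb N}\times E^{\mathbb N}$, where $\mathbb N=\{0,1,2,\dots\}$, with coordinate processes $(\hat X^+,\hat X^-)$, such that: (i) under $m$, $\hat X^+$ has the law of $X^+$ and $\hat X^-$ has the law of $X^-$; (ii) for every $n\ge 0$ and every measurable $D\subseteq E^{n+1}$, $$m\bigl[(\hat X^+_0,\dots,\hat X^+_n)\in D,\ \hat X^+_i=\hat X^-_i\text{ for all }0\le i\le n\bigr]=(\mu_n^+\wedge\mu_n^-)(D),$$ where $\mu_n^\pm$ is the law of $(X^\pm_0,\dots,X^\pm_n)$ and $\mu_n^+\wedge\mu_n^-$ is the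 meet measure, i.e. the largest measure lying below both $\mu_n^+$ and $\mu_n^-$ on every measurable set. In particular, the single measure $m$ maximizes, simultaneously for all $n\ge 0$, the probability $m[\hat X^+_i=\hat X^-_i\text{ for all }0\le i\le n]$ among all couplings of the laws of $X^+$ and $X^-$. -/

import Mathlib

open MeasureTheory

namespace MEXIT

/-- `m` is a coupling of `μ` and `ν`: a measure on the product space whose two marginals are
`μ` and `ν`. -/
structure IsCoupling {S T : Type*} [MeasurableSpace S] [MeasurableSpace T]
    (m : Measure (S × T)) (μ : Measure S) (ν : Measure T) : Prop where
  map_fst : m.map Prod.fst = μ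
  map_snd : m.map Prod.snd = ν

/-- The initial segment `(x 0, …, x n)` of a trajectory `x`. -/
def initialPath {E : Type*} (n : ℕ) (x : ℕ → E) : Finset.Iic n → E := fun i => x i

/-- The set of pairs of trajectories that have not split apart by time `n`. -/
def agreeUpTo (E : Type*) (n : ℕ) : Set ((ℕ → E) × (ℕ → E)) :=
  {ω | ∀ i ≤ n, ω.1 i = ω.2 i}

/-- A maximal exit (MEXIT) coupling, through all time, of two laws `μ`, `ν` on trajectory space:
a coupling such that, for every time `n`, the law of the common initial segment up to time `n` on
the event that the trajectories agree up to time `n` is the meet measure of the two laws of the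
initial segments. Here `⊓` is the infimum in the lattice of measures, that is, the largest measure
that lies below both measures on every measurable set. -/
structure IsMEXITCoupling {E : Type*} [MeasurableSpace E]
    (m : Measure ((ℕ → E) × (ℕ → E))) (μ ν : Measure (ℕ → E)) : Prop
    extends IsCoupling m μ ν where
  agree_eq_meet : ∀ (n : ℕ) (D : Set (Finset.Iic n → E)), MeasurableSet D →
    m ({ω | initialPath n ω.1 ∈ D} ∩ agreeUpTo E n)
      = (μ.map (initialPath n) ⊓ ν.map (initialPath n)) D

end MEXIT

/-! Let `l n` be the meet of the laws up to time `n`. Agreement through time `n` carries at most `l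
n` under any coupling (`IsCoupling.agree_le_meet`), so it remains to reach `l n` for all `n` at
once.

The core is to lift the `l n` to decreasing measures `R n ≤ μ` and `R' n ≤ ν` on whole trajectories,
both projecting to `l n` at time `n` (`exists_antitone_map_initialPath_eq`). The density of `l n` is
a supermartingale, and `exists_monotone_condExp_eq` realizes one minus it as the projection of a
nondecreasing process.

The decrements at `k` of the two sequences then have equal projections up to time `k`, so they can
be glued into pairs agreeing up to `k` (`exists_isCoupling_of_map_eq`). The sequences have a common
limit, which goes on the diagonal; the leftovers `μ - R 0` and `ν - R' 0` have equal mass and are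
paired arbitrarily. -/

open ProbabilityTheory Filter Topology

namespace MEXIT

/-! ### Submartingales in `[0, 1]` as projections of monotone processes. -/

section Submartingale

variable {Ω : Type*} {m0 : MeasurableSpace Ω} {μ : Measure Ω} {ℱ : Filtration ℕ m0}
  {a : ℕ → Ω → ℝ}

/-- The forward extension of `a n`: at each later time `j` it is multiplied by
`a (j + 1) / μ[a (j + 1) | ℱ j]`, so that it stays below `a` and becomes a martingale. -/
noncomputable def forwardExtension (μ : Measure Ω) (ℱ : Filtration ℕ m0) (a : ℕ → Ω → ℝ)
    (n : ℕ) : ℕ → Ω → ℝ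
  | 0 => a n
  | k + 1 => fun ω => forwardExtension μ ℱ a n k ω / (μ[a (n + k + 1) | ℱ (n + k)]) ω
      * a (n + k + 1) ω

lemma forwardExtension_stronglyMeasurable (ha : Submartingale a ℱ μ) (n k : ℕ) :
    StronglyMeasurable[ℱ (n + k)] (forwardExtension μ ℱ a n k) := by
  induction k with
  | zero => exact ha.stronglyAdapted n
  | succ k ih =>
    have h1 : StronglyMeasurable[ℱ (n + (k + 1))] (forwardExtension μ ℱ a n k) :=
      ih.mono (ℱ.mono (by omega))
    have h2 : StronglyMeasurable[ℱ (n + (k + 1))] (μ[a (n + k + 1) | ℱ (n + k)]) :=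
      stronglyMeasurable_condExp.mono (ℱ.mono (by omega))
    exact (h1.div h2).mul (ha.stronglyAdapted (n + k + 1))

/-- The ratio `w / b` stays in `[0, 1]` even for `b = 0`, where division returns zero. -/
lemma div_mul_le_of_le {w a b c : ℝ} (hw : 0 ≤ w) (hwa : w ≤ a) (hab : a ≤ b) (hc : 0 ≤ c) :
    0 ≤ w / b * c ∧ w / b * c ≤ c :=
  ⟨mul_nonneg (div_nonneg hw (hw.trans (hwa.trans hab))) hc,
    mul_le_of_le_one_left hc (div_le_one_of_le₀ (hwa.trans hab) (hw.trans (hwa.trans hab)))⟩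

/-- The submartingale property keeps each ratio at most one, hence the bound by `a`. The extension
begun at `n + 1` starts from `a (n + 1)`, above the one begun at `n`, and both then receive the same
multipliers; in the limit this gives monotonicity in `n`. -/
lemma forwardExtension_bounds (ha : Submartingale a ℱ μ) (h0 : ∀ n, 0 ≤ᵐ[μ] a n) :
    ∀ᵐ ω ∂μ, ∀ n k, 0 ≤ forwardExtension μ ℱ a n k ω ∧
      forwardExtension μ ℱ a n k ω ≤ a (n + k) ω ∧
      forwardExtension μ ℱ a n (k + 1) ω ≤ forwardExtension μ ℱ a (n + 1) k ω := by
  have hsub : ∀ᵐ ω ∂μ, ∀ j, a j ω ≤ (μ[a (j + 1) | ℱ j]) ω :=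
    ae_all_iff.2 fun j => ha.ae_le_condExp (Nat.le_succ j)
  filter_upwards [hsub, ae_all_iff.2 h0] with ω hs h0
  have hb : ∀ n k, 0 ≤ forwardExtension μ ℱ a n k ω ∧
      forwardExtension μ ℱ a n k ω ≤ a (n + k) ω := by
    intro n k
    induction k with
    | zero => exact ⟨h0 n, le_rfl⟩
    | succ k ih => exact div_mul_le_of_le ih.1 ih.2 (hs (n + k)) (h0 (n + k + 1))
  refine fun n k => ⟨(hb n k).1, (hb n k).2, ?_⟩
  induction k with
  | zero => exact (hb n 1).2
  | succ k ih =>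
    have e : n + 1 + k = n + (k + 1) := by omega
    change forwardExtension μ ℱ a n (k + 1) ω
        / (μ[a (n + (k + 1) + 1) | ℱ (n + (k + 1))]) ω * a (n + (k + 1) + 1) ω
      ≤ forwardExtension μ ℱ a (n + 1) k ω
        / (μ[a (n + 1 + k + 1) | ℱ (n + 1 + k)]) ω * a (n + 1 + k + 1) ω
    rw [e]
    exact mul_le_mul_of_nonneg_right
      (div_le_div_of_nonneg_right ih ((h0 _).trans (hs (n + (k + 1))))) (h0 _)

/-- The filtration `ℱ` shifted by `n`. -/
def shiftFiltration (ℱ : Filtration ℕ m0) (n : ℕ) : Filtration ℕ m0 where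
  seq k := ℱ (n + k)
  mono' _ _ h := ℱ.mono (Nat.add_le_add_left h n)
  le' k := ℱ.le (n + k)

lemma forwardExtension_integrable [IsFiniteMeasure μ] (ha : Submartingale a ℱ μ)
    (h0 : ∀ n, 0 ≤ᵐ[μ] a n) (n k : ℕ) : Integrable (forwardExtension μ ℱ a n k) μ := by
  refine (ha.integrable (n + k)).mono
    ((forwardExtension_stronglyMeasurable ha n k).mono (ℱ.le _)).aestronglyMeasurable ?_
  filter_upwards [forwardExtension_bounds ha h0] with ω h
  rw [Real.norm_of_nonneg (h n k).1]
  exact (h n k).2.1.trans (le_abs_self _)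

lemma forwardExtension_martingale [IsFiniteMeasure μ] (ha : Submartingale a ℱ μ)
    (h0 : ∀ n, 0 ≤ᵐ[μ] a n) (n : ℕ) :
    Martingale (forwardExtension μ ℱ a n) (shiftFiltration ℱ n) μ := by
  refine martingale_nat (fun k => forwardExtension_stronglyMeasurable ha n k)
    (forwardExtension_integrable ha h0 n) fun k => ?_
  have hpull : μ[forwardExtension μ ℱ a n (k + 1) | ℱ (n + k)] =ᵐ[μ]
      (forwardExtension μ ℱ a n k / μ[a (n + k + 1) | ℱ (n + k)])
        * μ[a (n + k + 1) | ℱ (n + k)] :=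
    condExp_mul_of_stronglyMeasurable_left
      ((forwardExtension_stronglyMeasurable ha n k).div stronglyMeasurable_condExp)
      (forwardExtension_integrable ha h0 n (k + 1)) (ha.integrable _)
  refine EventuallyEq.trans ?_ hpull.symm
  filter_upwards [forwardExtension_bounds ha h0, ha.ae_le_condExp (Nat.le_succ (n + k))]
    with ω h hs
  simp only [Pi.mul_apply, Pi.div_apply]
  -- Where the conditional expectation vanishes, the extension below it vanishes too.
  refine (div_mul_cancel_of_imp fun hz => ?_).symm
  exact le_antisymm (((h n k).2.1.trans hs).trans hz.le) (h n k).1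

/-- A submartingale with values in `[0, 1]` is the optional projection of a nondecreasing sequence
of random variables with values in `[0, 1]`. -/
theorem exists_monotone_condExp_eq [IsFiniteMeasure μ] (ha : Submartingale a ℱ μ)
    (h0 : ∀ n, 0 ≤ᵐ[μ] a n) (h1 : ∀ n, a n ≤ᵐ[μ] 1) :
    ∃ h : ℕ → Ω → ℝ, (∀ n, Measurable (h n)) ∧
      (∀ᵐ ω ∂μ, ∀ n, 0 ≤ h n ω ∧ h n ω ≤ 1 ∧ h n ω ≤ h (n + 1) ω) ∧
      ∀ n, μ[h n | ℱ n] =ᵐ[μ] a n := by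
  have hW : ∀ᵐ ω ∂μ, ∀ n k, 0 ≤ forwardExtension μ ℱ a n k ω ∧
      forwardExtension μ ℱ a n k ω ≤ 1 := by
    filter_upwards [forwardExtension_bounds ha h0, ae_all_iff.2 h1] with ω h h1 n k
    exact ⟨(h n k).1, (h n k).2.1.trans (h1 _)⟩
  have hnorm : ∀ n k, ∀ᵐ ω ∂μ, ‖forwardExtension μ ℱ a n k ω‖ ≤ 1 := by
    intro n k
    filter_upwards [hW] with ω h
    rw [Real.norm_of_nonneg (h n k).1]
    exact (h n k).2
  -- Bounded martingales converge almost everywhere; `limsup` is a version of the limit that is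
  -- measurable everywhere.
  have hlim : ∀ᵐ ω ∂μ, ∀ n, Tendsto (fun k => forwardExtension μ ℱ a n k ω) atTop
      (𝓝 (limsup (fun k => forwardExtension μ ℱ a n k ω) atTop)) := by
    refine ae_all_iff.2 fun n => ?_
    filter_upwards [(forwardExtension_martingale ha h0 n).submartingale.exists_ae_tendsto_of_bdd
      (R := (μ Set.univ).toNNReal) fun k => (eLpNorm_le_of_ae_bound (hnorm n k)).trans
        (by simp [ENNReal.coe_toNNReal (measure_ne_top μ _)])] with ω ⟨c, hc⟩
    rwa [hc.limsup_eq]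
  refine ⟨fun n ω => limsup (fun k => forwardExtension μ ℱ a n k ω) atTop,
    fun n => Measurable.limsup fun k =>
      ((forwardExtension_stronglyMeasurable ha n k).mono (ℱ.le _)).measurable, ?_, fun n => ?_⟩
  · filter_upwards [hlim, hW, forwardExtension_bounds ha h0] with ω hl hw hb n
    refine ⟨ge_of_tendsto' (hl n) fun k => (hw n k).1, le_of_tendsto' (hl n) fun k => (hw n k).2,
      le_of_tendsto_of_tendsto' ((tendsto_add_atTop_iff_nat 1).2 (hl n)) (hl (n + 1))
        fun k => (hb n k).2.2⟩
  · have hcond : ∀ k, μ[forwardExtension μ ℱ a n k | ℱ n] =ᵐ[μ] μ[a n | ℱ n] := by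
      intro k
      rw [condExp_of_stronglyMeasurable (ℱ.le n) (ha.stronglyAdapted n) (ha.integrable n)]
      exact (forwardExtension_martingale ha h0 n).condExp_ae_eq (Nat.zero_le k)
    refine (tendsto_condExp_unique _ (fun _ => a n) _ (a n) (forwardExtension_integrable ha h0 n)
      (fun _ => ha.integrable n) (hlim.mono fun ω h => h n)
      (ae_of_all _ fun ω => tendsto_const_nhds) (fun _ => 1) (integrable_const 1) (fun _ => 1)
      (integrable_const 1) (hnorm n) (fun _ => hnorm n 0) hcond).trans ?_
    rw [condExp_of_stronglyMeasurable (ℱ.le n) (ha.stronglyAdapted n) (ha.integrable n)]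

end Submartingale

/-! ### Lifting measures on initial segments to trajectory space. -/

section Paths

variable {E : Type*}

/-- The restriction of an initial segment to an earlier time. -/
def restrictPath {j k : ℕ} (h : j ≤ k) (x : Finset.Iic k → E) : Finset.Iic j → E :=
  fun i => x ⟨i, Finset.Iic_subset_Iic.2 h i.2⟩

lemma restrictPath_comp_initialPath {j k : ℕ} (h : j ≤ k) :
    restrictPath (E := E) h ∘ initialPath k = initialPath j := rfl

variable [MeasurableSpace E]

lemma measurable_initialPath (n : ℕ) : Measurable (initialPath (E := E) n) :=
  measurable_pi_lambda _ fun i => measurable_pi_apply (i : ℕ)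

lemma measurable_restrictPath {j k : ℕ} (h : j ≤ k) : Measurable (restrictPath (E := E) h) :=
  measurable_pi_lambda _ fun _ => measurable_pi_apply _

lemma map_initialPath_map_restrictPath {j k : ℕ} (h : j ≤ k) (μ : Measure (ℕ → E)) :
    (μ.map (initialPath k)).map (restrictPath h) = μ.map (initialPath j) := by
  rw [Measure.map_map (measurable_restrictPath h) (measurable_initialPath k),
    restrictPath_comp_initialPath]

/-- A finite measure on trajectory space is determined by its images on initial segments. -/
lemma ext_of_map_initialPath {μ ν : Measure (ℕ → E)} [IsFiniteMeasure μ]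
    (h : ∀ n, μ.map (initialPath n) = ν.map (initialPath n)) : μ = ν := by
  have hP : IsProjectiveMeasureFamily (fun I : Finset ℕ => μ.map I.restrict) :=
    isProjectiveMeasureFamily_map_restrict (X := fun (t : ℕ) (ω : ℕ → E) => ω t)
      fun t => (measurable_pi_apply t).aemeasurable
  exact IsProjectiveLimit.unique (P := fun I : Finset ℕ => μ.map I.restrict) (fun _ => rfl)
    ((isProjectiveLimit_nat_iff hP ν).2 fun n => (h n).symm)

/-- The filtration on trajectory space generated by the initial segments. -/
def pathFiltration (E : Type*) [MeasurableSpace E] :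
    Filtration ℕ (MeasurableSpace.pi : MeasurableSpace (ℕ → E)) where
  seq n := MeasurableSpace.comap (initialPath n) inferInstance
  mono' j k h := by
    change MeasurableSpace.comap (restrictPath h ∘ initialPath k) _ ≤ _
    rw [← MeasurableSpace.comap_comp]
    exact MeasurableSpace.comap_mono (measurable_restrictPath h).comap_le
  le' n := (measurable_initialPath n).comap_le

/-- A sequence of measures on initial segments which is dominated by the laws of the initial
segments of `μ` and decreases under projection is the sequence of projections of a decreasing
sequence of measures below `μ`. -/
theorem exists_antitone_map_initialPath_eq (μ : Measure (ℕ → E)) [IsFiniteMeasure μ]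
    (l : ∀ n : ℕ, Measure (Finset.Iic n → E)) (hl : ∀ n, l n ≤ μ.map (initialPath n))
    (hmono : ∀ n, (l (n + 1)).map (restrictPath (Nat.le_succ n)) ≤ l n) :
    ∃ R : ℕ → Measure (ℕ → E), (∀ n, R (n + 1) ≤ R n) ∧ (∀ n, R n ≤ μ) ∧
      ∀ n, (R n).map (initialPath n) = l n := by
  have hfin : ∀ n, IsFiniteMeasure (l n) := fun n => isFiniteMeasure_of_le _ (hl n)
  let d : ∀ n : ℕ, (Finset.Iic n → E) → ℝ := fun n x =>
    ((l n).rnDeriv (μ.map (initialPath n)) x).toReal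
  have hd_meas : ∀ n, Measurable (d n) := fun n => (Measure.measurable_rnDeriv _ _).ennreal_toReal
  have hd_le : ∀ n, ∀ᵐ ω ∂μ, d n (initialPath n ω) ≤ 1 := by
    intro n
    filter_upwards [ae_of_ae_map (measurable_initialPath n).aemeasurable
      (Measure.rnDeriv_le_one_of_le (hl n))] with ω h
    exact ENNReal.toReal_mono ENNReal.one_ne_top h
  have hd_nonneg : ∀ n x, 0 ≤ d n x := fun n x => ENNReal.toReal_nonneg
  have hd_int : ∀ n, Integrable (fun ω => d n (initialPath n ω)) μ := by
    intro n
    refine (integrable_const (1 : ℝ)).mono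
      ((hd_meas n).comp (measurable_initialPath n)).aestronglyMeasurable ?_
    filter_upwards [hd_le n] with ω h
    rw [Real.norm_of_nonneg (hd_nonneg n _), norm_one]
    exact h
  have hd_set : ∀ n (D : Set (Finset.Iic n → E)), MeasurableSet D →
      ∫ ω in initialPath n ⁻¹' D, (1 - d n (initialPath n ω)) ∂μ
        = μ.real (initialPath n ⁻¹' D) - (l n).real D := by
    intro n D hD
    rw [integral_sub (integrable_const _).integrableOn (hd_int n).integrableOn,
      ← setIntegral_map hD (hd_meas n).aestronglyMeasurable
        (measurable_initialPath n).aemeasurable,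
      Measure.setIntegral_toReal_rnDeriv (Measure.absolutelyContinuous_of_le (hl n))]
    simp
  -- On an event known at time `n`, the integral is the `μ`-mass minus the `l n`-mass, so the
  -- submartingale inequality is `hmono`.
  have hsub : Submartingale (fun n ω => 1 - d n (initialPath n ω)) (pathFiltration E) μ := by
    refine submartingale_of_setIntegral_le_succ (fun n => ?_)
      (fun n => (integrable_const _).sub (hd_int n)) ?_
    · exact (measurable_const.sub
        ((hd_meas n).comp (comap_measurable (initialPath n)))).stronglyMeasurable
    · rintro n _ ⟨D, hD, rfl⟩
      have hD' := measurable_restrictPath (Nat.le_succ n) hD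
      rw [hd_set n D hD]
      refine le_of_le_of_eq ?_ (hd_set (n + 1) _ hD').symm
      refine sub_le_sub le_rfl ?_
      refine ENNReal.toReal_mono (measure_ne_top _ _) ?_
      rw [← Measure.map_apply (measurable_restrictPath _) hD]
      exact hmono n D
  obtain ⟨h, h_meas, h_bd, h_cond⟩ := exists_monotone_condExp_eq hsub
    (fun n => (hd_le n).mono fun ω h => sub_nonneg.2 h)
    (fun n => ae_of_all _ fun ω => sub_le_self _ (hd_nonneg n _))
  have h_int : ∀ n, Integrable (h n) μ := by
    intro n
    refine (integrable_const (1 : ℝ)).mono (h_meas n).aestronglyMeasurable ?_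
    filter_upwards [h_bd] with ω h
    rw [Real.norm_of_nonneg (h n).1, norm_one]
    exact (h n).2.1
  -- On events known at time `n`, conditioning replaces `1 - h n` by the density `d n` of `l n`.
  refine ⟨fun n => μ.withDensity fun ω => ENNReal.ofReal (1 - h n ω), fun n => ?_, fun n => ?_,
    fun n => ?_⟩
  · refine withDensity_mono ?_
    filter_upwards [h_bd] with ω h
    exact ENNReal.ofReal_le_ofReal (sub_le_sub le_rfl (h n).2.2)
  · conv_rhs => rw [← withDensity_one (μ := μ)]
    refine withDensity_mono ?_
    filter_upwards [h_bd] with ω h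
    exact ENNReal.ofReal_le_one.2 (sub_le_self _ (h n).1)
  · ext D hD
    have hs := measurable_initialPath n hD
    rw [Measure.map_apply (measurable_initialPath n) hD, withDensity_apply _ hs,
      ← ofReal_integral_eq_lintegral_ofReal (f := fun ω => 1 - h n ω)
        ((integrable_const _).sub (h_int n)).integrableOn
        (ae_restrict_of_ae (h_bd.mono fun ω h => sub_nonneg.2 (h n).2.1)),
      integral_sub (integrable_const _).integrableOn (h_int n).integrableOn,
      ← setIntegral_condExp ((pathFiltration E).le n) (h_int n) ⟨D, hD, rfl⟩,
      integral_congr_ae (ae_restrict_of_ae (h_cond n)), hd_set n D hD]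
    simp

end Paths

/-! ### Gluing two measures along a common image. -/

section Gluing

variable {S T U : Type*} [MeasurableSpace S] [MeasurableSpace T] [MeasurableSpace U]

/-- The joint law of `(f x, x)` lives on the graph of `f`, so almost every conditional law lives on
its fibre. -/
lemma ae_ae_condDistrib_id [StandardBorelSpace S] [Nonempty S] [MeasurableEq U]
    (a : Measure S) [IsFiniteMeasure a] {f : S → U} (hf : Measurable f) :
    ∀ᵐ u ∂(a.map f), ∀ᵐ x ∂(condDistrib id f a u), f x = u := by
  refine Measure.ae_ae_of_ae_compProd (p := fun z : U × S => f z.2 = z.1) ?_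
  rw [compProd_map_condDistrib measurable_id.aemeasurable]
  exact (ae_map_iff (p := fun z : U × S => f z.2 = z.1) (hf.prodMk measurable_id).aemeasurable
    (measurableSet_diagonal.preimage ((hf.comp measurable_snd).prodMk measurable_fst))).2
    (ae_of_all _ fun _ => rfl)

lemma bind_condDistrib_id [StandardBorelSpace S] [Nonempty S]
    (a : Measure S) [IsFiniteMeasure a] {f : S → U} (hf : Measurable f) :
    (a.map f).bind (condDistrib id f a) = a := by
  rw [condDistrib_comp_map hf.aemeasurable measurable_id.aemeasurable, Measure.map_id]

/-- Gluing: two finite measures with a common image can be coupled so that the images agree. -/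
theorem exists_isCoupling_of_map_eq [StandardBorelSpace S] [Nonempty S] [StandardBorelSpace T]
    [Nonempty T] [MeasurableEq U] (a : Measure S) [IsFiniteMeasure a] (b : Measure T)
    [IsFiniteMeasure b] {f : S → U} {g : T → U} (hf : Measurable f) (hg : Measurable g)
    (h : a.map f = b.map g) :
    ∃ m : Measure (S × T), IsCoupling m a b ∧ ∀ᵐ ω ∂m, f ω.1 = g ω.2 := by
  -- Draw the common image, then both points independently from their conditional laws given it.
  refine ⟨(a.map f).bind (condDistrib id f a ×ₖ condDistrib id g b), ⟨?_, ?_⟩, ?_⟩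
  · rw [Measure.map_comp _ _ measurable_fst, ← Kernel.fst_eq, Kernel.fst_prod,
      bind_condDistrib_id a hf]
  · rw [Measure.map_comp _ _ measurable_snd, ← Kernel.snd_eq, Kernel.snd_prod, h,
      bind_condDistrib_id b hg]
  · refine Measure.ae_comp_of_ae_ae
      (measurableSet_diagonal.preimage ((hf.comp measurable_fst).prodMk (hg.comp measurable_snd))) ?_
    have hb := ae_ae_condDistrib_id b hg
    rw [← h] at hb
    filter_upwards [ae_ae_condDistrib_id a hf, hb] with u hu hv
    rw [Kernel.prod_apply]
    filter_upwards [Measure.quasiMeasurePreserving_fst.ae hu,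
      Measure.quasiMeasurePreserving_snd.ae hv] with ω h1 h2
    exact h1.trans h2.symm

end Gluing

/-! ### Telescoping of decreasing measures. -/

section Decomposition

variable {S : Type*} [MeasurableSpace S]

lemma sum_nat_eq_add_sum_succ (D : ℕ → Measure S) :
    Measure.sum D = D 0 + Measure.sum fun k => D (k + 1) := by
  ext s hs
  rw [Measure.add_apply, Measure.sum_apply _ hs, Measure.sum_apply _ hs,
    tsum_eq_zero_add' ENNReal.summable]

/-- A decreasing sequence of finite measures is the sum of a limit and of its later decrements. -/
lemma exists_add_sum_decrements (R : ℕ → Measure S) [∀ n, IsFiniteMeasure (R n)]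
    (hR : ∀ n, R (n + 1) ≤ R n) :
    ∃ L : Measure S, ∀ n, R n = L + Measure.sum fun k => R (n + k) - R (n + k + 1) := by
  let D : ℕ → Measure S := fun k => R k - R (k + 1)
  have hD : ∀ k, D k + R (k + 1) = R k := fun k => Measure.sub_add_cancel_of_le (hR k)
  have hpart : ∀ N s, ∑ k ∈ Finset.range N, D k s + R N s = R 0 s := by
    intro N s
    induction N with
    | zero => simp
    | succ N ih =>
      rw [Finset.sum_range_succ, add_assoc, ← Measure.add_apply, hD, ih]
  have hle : Measure.sum D ≤ R 0 := by
    refine Measure.le_iff.2 fun s hs => ?_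
    rw [Measure.sum_apply _ hs, ENNReal.tsum_eq_iSup_nat]
    exact iSup_le fun N => le_self_add.trans (hpart N s).le
  have : IsFiniteMeasure (Measure.sum D) := isFiniteMeasure_of_le _ hle
  refine ⟨R 0 - Measure.sum D, fun n => ?_⟩
  induction n with
  | zero =>
    simp only [zero_add]
    exact (Measure.sub_add_cancel_of_le hle).symm
  | succ n ih =>
    have : IsFiniteMeasure (D n) := isFiniteMeasure_of_le (R n) Measure.sub_le
    have hs : (Measure.sum fun k => R (n + k) - R (n + k + 1))
        = D n + Measure.sum fun k => R (n + 1 + k) - R (n + 1 + k + 1) := by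
      rw [sum_nat_eq_add_sum_succ fun k => R (n + k) - R (n + k + 1)]
      simp only [Nat.add_right_comm n 1]
      rfl
    refine (Measure.add_left_inj (D n) _ _).1 ?_
    rw [add_comm, hD n, ih, hs, add_assoc, add_comm (D n)]

end Decomposition

/-! ### Construction and maximality of the coupling. -/

section Coupling

variable {E : Type*}

lemma initialPath_eq_iff {n : ℕ} {x y : ℕ → E} :
    initialPath n x = initialPath n y ↔ ∀ i ≤ n, x i = y i :=
  ⟨fun h i hi => congrFun h ⟨i, Finset.mem_Iic.2 hi⟩,
    fun h => funext fun i => h i (Finset.mem_Iic.1 i.2)⟩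

variable [MeasurableSpace E]

lemma measurableSet_agreeUpTo [MeasurableEq E] (n : ℕ) : MeasurableSet (agreeUpTo E n) := by
  simp only [agreeUpTo, Set.ofPred_forall]
  refine MeasurableSet.iInter fun i => MeasurableSet.iInter fun _ => ?_
  exact measurableSet_diagonal.preimage (((measurable_pi_apply i).comp measurable_fst).prodMk
    ((measurable_pi_apply i).comp measurable_snd))

/-- Under any coupling, the law of the initial segment on the event of agreement lies below the
meet of the two laws of the initial segments. -/
theorem IsCoupling.agree_le_meet [MeasurableEq E] {m : Measure ((ℕ → E) × (ℕ → E))}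
    {μ ν : Measure (ℕ → E)} (h : IsCoupling m μ ν) (n : ℕ) {D : Set (Finset.Iic n → E)}
    (hD : MeasurableSet D) :
    m ({ω | initialPath n ω.1 ∈ D} ∩ agreeUpTo E n)
      ≤ (μ.map (initialPath n) ⊓ ν.map (initialPath n)) D := by
  have hf : Measurable (initialPath n ∘ Prod.fst : (ℕ → E) × (ℕ → E) → _) :=
    (measurable_initialPath n).comp measurable_fst
  have hg : Measurable (initialPath n ∘ Prod.snd : (ℕ → E) × (ℕ → E) → _) :=
    (measurable_initialPath n).comp measurable_snd
  have hfg : (m.restrict (agreeUpTo E n)).map (initialPath n ∘ Prod.fst)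
      = (m.restrict (agreeUpTo E n)).map (initialPath n ∘ Prod.snd) :=
    Measure.map_congr ((ae_restrict_mem (measurableSet_agreeUpTo n)).mono
      fun ω hω => initialPath_eq_iff.2 hω)
  have hle : (m.restrict (agreeUpTo E n)).map (initialPath n ∘ Prod.fst)
      ≤ μ.map (initialPath n) ⊓ ν.map (initialPath n) := by
    refine le_inf ?_ ?_
    · rw [← h.map_fst, Measure.map_map (measurable_initialPath n) measurable_fst]
      exact Measure.map_mono Measure.restrict_le_self hf
    · rw [hfg, ← h.map_snd, Measure.map_map (measurable_initialPath n) measurable_snd]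
      exact Measure.map_mono Measure.restrict_le_self hg
  refine le_of_eq_of_le ?_ (hle D)
  rw [Measure.map_apply hf hD, Measure.restrict_apply (hf hD)]
  rfl

lemma map_meet_le (μ ν : Measure (ℕ → E)) {j k : ℕ} (h : j ≤ k) :
    (μ.map (initialPath k) ⊓ ν.map (initialPath k)).map (restrictPath h)
      ≤ μ.map (initialPath j) ⊓ ν.map (initialPath j) := by
  rw [← map_initialPath_map_restrictPath h μ, ← map_initialPath_map_restrictPath h ν]
  exact le_inf (Measure.map_mono inf_le_left (measurable_restrictPath h))
    (Measure.map_mono inf_le_right (measurable_restrictPath h))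

lemma map_initialPath_eq_of_le {a b : Measure (ℕ → E)} {j k : ℕ} (h : j ≤ k)
    (hab : a.map (initialPath k) = b.map (initialPath k)) :
    a.map (initialPath j) = b.map (initialPath j) := by
  rw [← map_initialPath_map_restrictPath h a, hab, map_initialPath_map_restrictPath h]

/-- Two decreasing sequences of finite measures on trajectory space with the same projections on
initial segments have decrements with the same projections. -/
lemma map_initialPath_sub_eq {R R' : ℕ → Measure (ℕ → E)} [∀ n, IsFiniteMeasure (R n)]
    [∀ n, IsFiniteMeasure (R' n)] (hR : ∀ n, R (n + 1) ≤ R n) (hR' : ∀ n, R' (n + 1) ≤ R' n)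
    (h : ∀ n, (R n).map (initialPath n) = (R' n).map (initialPath n)) (k : ℕ) :
    (R k - R (k + 1)).map (initialPath k) = (R' k - R' (k + 1)).map (initialPath k) := by
  have hk := h k
  rw [← Measure.sub_add_cancel_of_le (hR k), ← Measure.sub_add_cancel_of_le (hR' k),
    Measure.map_add _ _ (measurable_initialPath k), Measure.map_add _ _ (measurable_initialPath k),
    map_initialPath_eq_of_le (Nat.le_succ k) (h (k + 1)), Measure.add_left_inj] at hk
  exact hk

/-- Two decreasing sequences of finite measures on trajectory space with the same projections on
initial segments have the same limit. -/
lemma limit_eq_of_map_initialPath_eq {R R' : ℕ → Measure (ℕ → E)} [∀ n, IsFiniteMeasure (R n)]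
    [∀ n, IsFiniteMeasure (R' n)] (hR : ∀ n, R (n + 1) ≤ R n) (hR' : ∀ n, R' (n + 1) ≤ R' n)
    (h : ∀ n, (R n).map (initialPath n) = (R' n).map (initialPath n)) {L L' : Measure (ℕ → E)}
    (hL : ∀ n, R n = L + Measure.sum fun k => R (n + k) - R (n + k + 1))
    (hL' : ∀ n, R' n = L' + Measure.sum fun k => R' (n + k) - R' (n + k + 1)) : L = L' := by
  have : IsFiniteMeasure L := isFiniteMeasure_of_le (R 0) (by rw [hL 0]; exact Measure.le_add_right le_rfl)
  refine ext_of_map_initialPath fun n => ?_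
  have hπ := measurable_initialPath (E := E) n
  have hfin : IsFiniteMeasure (Measure.sum fun k => R' (n + k) - R' (n + k + 1)) :=
    isFiniteMeasure_of_le (R' n) (by conv_rhs => rw [hL' n]
                                     exact Measure.le_add_left le_rfl)
  -- Only decrements from index `n` on occur, and these already match up to time `n`; cancelling
  -- their finite sum isolates the limits.
  have hsum : (Measure.sum fun k => R (n + k) - R (n + k + 1)).map (initialPath n)
      = (Measure.sum fun k => R' (n + k) - R' (n + k + 1)).map (initialPath n) := by
    rw [Measure.map_sum hπ.aemeasurable, Measure.map_sum hπ.aemeasurable]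
    congr 1
    funext k
    exact map_initialPath_eq_of_le (Nat.le_add_right n k) (map_initialPath_sub_eq hR hR' h (n + k))
  have hn := h n
  rw [hL n, hL' n, Measure.map_add _ _ hπ, Measure.map_add _ _ hπ, hsum,
    Measure.add_left_inj] at hn
  exact hn

/-- Two finite measures of the same mass have a coupling. -/
lemma exists_isCoupling_of_univ_eq {S : Type*} [MeasurableSpace S] [StandardBorelSpace S]
    [Nonempty S] (a b : Measure S) [IsFiniteMeasure a] [IsFiniteMeasure b]
    (h : a Set.univ = b Set.univ) : ∃ m : Measure (S × S), IsCoupling m a b := by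
  obtain ⟨m, hm, -⟩ := exists_isCoupling_of_map_eq a b (f := fun _ => ()) (g := fun _ => ())
    measurable_const measurable_const (by simp [Measure.map_const, h])
  exact ⟨m, hm⟩

lemma map_initialPath_univ (μ : Measure (ℕ → E)) (n : ℕ) :
    μ.map (initialPath n) Set.univ = μ Set.univ := by
  rw [Measure.map_apply (measurable_initialPath n) MeasurableSet.univ, Set.preimage_univ]

/-- Any two probability measures on the trajectory space of a standard Borel space have a MEXIT
coupling. -/
theorem exists_isMEXITCoupling [StandardBorelSpace E] [Nonempty E] (μ ν : Measure (ℕ → E))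
    [IsProbabilityMeasure μ] [IsProbabilityMeasure ν] :
    ∃ m : Measure ((ℕ → E) × (ℕ → E)), IsMEXITCoupling m μ ν := by
  let l : ∀ n : ℕ, Measure (Finset.Iic n → E) :=
    fun n => μ.map (initialPath n) ⊓ ν.map (initialPath n)
  have hl : ∀ n, (l (n + 1)).map (restrictPath (Nat.le_succ n)) ≤ l n :=
    fun n => map_meet_le μ ν (Nat.le_succ n)
  obtain ⟨R, hR, hRμ, hRl⟩ :=
    exists_antitone_map_initialPath_eq μ l (fun n => inf_le_left) hl
  obtain ⟨R', hR', hRν, hRl'⟩ :=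
    exists_antitone_map_initialPath_eq ν l (fun n => inf_le_right) hl
  have hfin : ∀ n, IsFiniteMeasure (R n) := fun n => isFiniteMeasure_of_le _ (hRμ n)
  have hfin' : ∀ n, IsFiniteMeasure (R' n) := fun n => isFiniteMeasure_of_le _ (hRν n)
  have hRR : ∀ n, (R n).map (initialPath n) = (R' n).map (initialPath n) :=
    fun n => (hRl n).trans (hRl' n).symm
  obtain ⟨L, hL⟩ := exists_add_sum_decrements R hR
  obtain ⟨L', hL'⟩ := exists_add_sum_decrements R' hR'
  obtain rfl : L = L' := limit_eq_of_map_initialPath_eq hR hR' hRR hL hL'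
  have hsplit : ∀ k, ∃ m : Measure ((ℕ → E) × (ℕ → E)),
      IsCoupling m (R k - R (k + 1)) (R' k - R' (k + 1)) ∧
        ∀ᵐ ω ∂m, initialPath k ω.1 = initialPath k ω.2 := by
    intro k
    have : IsFiniteMeasure (R k - R (k + 1)) := isFiniteMeasure_of_le (R k) Measure.sub_le
    have : IsFiniteMeasure (R' k - R' (k + 1)) := isFiniteMeasure_of_le (R' k) Measure.sub_le
    exact exists_isCoupling_of_map_eq _ _ (measurable_initialPath k) (measurable_initialPath k)
      (map_initialPath_sub_eq hR hR' hRR k)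
  choose c hc hc_eq using hsplit
  have : IsFiniteMeasure (μ - R 0) := isFiniteMeasure_of_le μ Measure.sub_le
  have : IsFiniteMeasure (ν - R' 0) := isFiniteMeasure_of_le ν Measure.sub_le
  obtain ⟨c₀, hc₀⟩ := exists_isCoupling_of_univ_eq (μ - R 0) (ν - R' 0) (by
    rw [Measure.sub_apply MeasurableSet.univ (hRμ 0), Measure.sub_apply MeasurableSet.univ (hRν 0),
      measure_univ (μ := μ), measure_univ (μ := ν), ← map_initialPath_univ (R 0) 0, hRR 0, map_initialPath_univ])
  have hdiag : Measurable fun x : ℕ → E => (x, x) := measurable_id.prodMk measurable_id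
  -- `M n` gathers the never-split pairs and the pieces glued up to time `n` or later, so it lives
  -- on agreement up to `n` and has marginals `R n`, `R' n`.
  let M : ℕ → Measure ((ℕ → E) × (ℕ → E)) :=
    fun n => L.map (fun x => (x, x)) + Measure.sum fun k => c (n + k)
  have hM_fst : ∀ n, (M n).map Prod.fst = R n := by
    intro n
    rw [hL n, Measure.map_add _ _ measurable_fst, Measure.map_sum measurable_fst.aemeasurable,
      Measure.map_map measurable_fst hdiag]
    simp only [(hc _).map_fst]
    congr 1
    exact Measure.map_id
  have hM_snd : ∀ n, (M n).map Prod.snd = R' n := by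
    intro n
    rw [hL' n, Measure.map_add _ _ measurable_snd, Measure.map_sum measurable_snd.aemeasurable,
      Measure.map_map measurable_snd hdiag]
    simp only [(hc _).map_snd]
    congr 1
    exact Measure.map_id
  have hM_le : ∀ n, M n ≤ M 0 := by
    intro n
    refine add_le_add le_rfl (Measure.le_iff.2 fun s hs => ?_)
    rw [Measure.sum_apply _ hs, Measure.sum_apply _ hs]
    simp only [zero_add]
    exact ENNReal.tsum_comp_le_tsum_of_injective (add_right_injective n) fun k => c k s
  have hM_agree : ∀ n, ∀ᵐ ω ∂(M n), ω ∈ agreeUpTo E n := by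
    intro n
    refine ae_add_measure_iff.2 ⟨(ae_map_iff hdiag.aemeasurable (measurableSet_agreeUpTo n)).2
      (ae_of_all _ fun x i _ => rfl), Measure.ae_sum_iff.2 fun k => ?_⟩
    filter_upwards [hc_eq (n + k)] with ω hω i hi
    exact initialPath_eq_iff.1 hω i (hi.trans (Nat.le_add_right n k))
  have hcoup : IsCoupling (c₀ + M 0) μ ν :=
    ⟨by rw [Measure.map_add _ _ measurable_fst, hc₀.map_fst, hM_fst,
        Measure.sub_add_cancel_of_le (hRμ 0)],
      by rw [Measure.map_add _ _ measurable_snd, hc₀.map_snd, hM_snd,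
        Measure.sub_add_cancel_of_le (hRν 0)]⟩
  -- Other pieces might also agree up to `n`; the upper bound valid for every coupling makes that
  -- contribution null, so only the lower bound from `M n` is needed.
  refine ⟨c₀ + M 0, hcoup, fun n D hD => le_antisymm (hcoup.agree_le_meet n hD) ?_⟩
  calc l n D = M n {ω | initialPath n ω.1 ∈ D} := by
        rw [← hRl n, ← hM_fst n, Measure.map_map (measurable_initialPath n) measurable_fst,
          Measure.map_apply ((measurable_initialPath n).comp measurable_fst) hD]
        rfl
    _ ≤ M n ({ω | initialPath n ω.1 ∈ D} ∩ agreeUpTo E n) :=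
        measure_mono_ae ((hM_agree n).mono fun ω h1 h2 => ⟨h2, h1⟩)
    _ ≤ (c₀ + M 0) ({ω | initialPath n ω.1 ∈ D} ∩ agreeUpTo E n) :=
        Measure.le_add_left (hM_le n) _

/-- A MEXIT coupling maximizes all the agreement probabilities among all couplings. -/
theorem IsMEXITCoupling.agreeUpTo_le [MeasurableEq E] {m m' : Measure ((ℕ → E) × (ℕ → E))}
    {μ ν : Measure (ℕ → E)} (h : IsMEXITCoupling m μ ν) (h' : IsCoupling m' μ ν) (n : ℕ) :
    m' (agreeUpTo E n) ≤ m (agreeUpTo E n) := by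
  have h1 := h'.agree_le_meet n MeasurableSet.univ
  rw [← h.agree_eq_meet n _ MeasurableSet.univ] at h1
  simpa using h1

end Coupling

end MEXIT

theorem mainTheorem3 {E : Type*} [MeasurableSpace E] [StandardBorelSpace E]
    {Ωp Ωm : Type*} [MeasurableSpace Ωp] [MeasurableSpace Ωm]
    (Pp : Measure Ωp) [IsProbabilityMeasure Pp] (Pm : Measure Ωm) [IsProbabilityMeasure Pm]
    (Xp : ℕ → Ωp → E) (Xm : ℕ → Ωm → E)
    (hXp : ∀ t, Measurable (Xp t)) (hXm : ∀ t, Measurable (Xm t))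
    (x₀ : E) (hp0 : ∀ᵐ ω ∂Pp, Xp 0 ω = x₀) (hm0 : ∀ᵐ ω ∂Pm, Xm 0 ω = x₀) :
    ∃ m : Measure ((ℕ → E) × (ℕ → E)),
      MEXIT.IsMEXITCoupling m (Pp.map fun ω t => Xp t ω) (Pm.map fun ω t => Xm t ω) ∧
      ∀ m' : Measure ((ℕ → E) × (ℕ → E)),
        MEXIT.IsCoupling m' (Pp.map fun ω t => Xp t ω) (Pm.map fun ω t => Xm t ω) →
        ∀ n : ℕ, m' (MEXIT.agreeUpTo E n) ≤ m (MEXIT.agreeUpTo E n) := by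
  have : Nonempty E := ⟨x₀⟩
  have : IsProbabilityMeasure (Pp.map fun ω t => Xp t ω) :=
    Measure.isProbabilityMeasure_map (measurable_pi_lambda _ hXp).aemeasurable
  have : IsProbabilityMeasure (Pm.map fun ω t => Xm t ω) :=
    Measure.isProbabilityMeasure_map (measurable_pi_lambda _ hXm).aemeasurable
  obtain ⟨m, hm⟩ :=
    MEXIT.exists_isMEXITCoupling (Pp.map fun ω t => Xp t ω) (Pm.map fun ω t => Xm t ω)
  exact ⟨m, hm, fun m' hm' n => hm.agreeUpTo_le hm' n⟩
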